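/- Let $\mathcal{H}$ be a separable infinite-dimensional complex Hilbert space. A $C_0$-semigroup on $\mathcal{H}$ is a family $T=(T(t))_{t\in[0,\infty)}$ of bounded linear operators on $\mathcal{H}$ with $T(0)=I$, $T(s+t)=T(s)T(t)$ for all $s,t\ge 0$, and $t\mapsto T(t)\xi$ norm-continuous for every $\xi\in\mathcal{H}$; it is called unitary (respectively contractive) if every $T(t)$ is a unitary operator (respectively satisfies $\|T(t)\|\le 1$). Let $\mathcal{U}_s(\mathbb{R}_+)\subseteq\mathcal{C}_s(\mathbb{R}_+)$ denote the sets of unitary and of contractive $C_0$-semigroups on $\mathcal{H}$. On these sets let $k_{\mathrm{sot}}$ be the topology in which a net $(T_i)_i$ converges to $T$ if and only if $\sup_{t\in K}\|(T_i(t)-T(t))\xi\|\to 0$ for all $\xi\in\mathcal{H}$ and all compact $K\subseteq[0,\infty)$, and let $k_{\mathrm{wot}}$ be the topology in which $(T_i)_i$ converges to $T$ if and only if $\sup_{t\in K}|\langle (T_i(t)-T(t))\xi,\eta\rangle|\to 0$ for all $\xi,\eta\in\mathcal{H}$ and all compact $K\subseteq[0,\infty)$. A subset of a topological space is residual if it contains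 a countable intersection of dense open sets. Let $\Phi(\cdot)$ be any property of $C_0$-semigroups on $\mathcal{H}$. Then the following are equivalent: (i) $\{T\in\mathcal{U}_s(\mathbb{R}_+)\mid\Phi(T)\}$ is residual in $(\mathcal{U}_s(\mathbb{R}_+),k_{\mathrm{sot}})$; (ii) $\{T\in\mathcal{U}_s(\mathbb{R}_+)\mid\Phi(T)\}$ is residual in $(\mathcal{U}_s(\mathbb{R}_+),k_{\mathrm{wot}})$; (iii) $\{T\in\mathcal{C}_s(\mathbb{R}_+)\mid\Phi(T)\}$ is residual in $(\mathcal{C}_s(\mathbb{R}_+),k_{\mathrm{wot}})$. -/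

import Mathlib

open Filter Topology
open scoped NNReal UniformConvergence

/-- A `C₀`-semigroup on `H`: a strongly continuous family `(T t)`, `t ∈ [0, ∞)`, of bounded linear
operators on `H` with `T 0 = I` and `T (s + t) = T s T t`. -/
structure C0Semigroup (H : Type*) [NormedAddCommGroup H] [InnerProductSpace ℂ H] where
  /-- The underlying operator-valued function. -/
  toFun : ℝ≥0 → H →L[ℂ] H
  map_zero' : toFun 0 = ContinuousLinearMap.id ℂ H
  map_add' : ∀ s t : ℝ≥0, toFun (s + t) = (toFun s).comp (toFun t)
  sot_continuous' : ∀ ξ : H, Continuous fun t : ℝ≥0 => toFun t ξ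

namespace C0Semigroup

instance instCoeFun (H : Type*) [NormedAddCommGroup H] [InnerProductSpace ℂ H] :
    CoeFun (C0Semigroup H) (fun _ => ℝ≥0 → H →L[ℂ] H) :=
  ⟨C0Semigroup.toFun⟩

/-- The set of contractive `C₀`-semigroups on `H`. -/
def contractive (H : Type*) [NormedAddCommGroup H] [InnerProductSpace ℂ H] :
    Set (C0Semigroup H) :=
  {T | ∀ t, ‖T t‖ ≤ 1}

/-- The set of unitary `C₀`-semigroups on `H`. -/
def unitaries (H : Type*) [NormedAddCommGroup H] [InnerProductSpace ℂ H] [CompleteSpace H] :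
    Set (C0Semigroup H) :=
  {T | ∀ t, T t ∈ unitary (H →L[ℂ] H)}

/-- The topology of uniform strong operator convergence on compact subsets of `[0, ∞)`: the
coarsest one for which, for every `ξ`, the map `T ↦ (t ↦ T t ξ)` is continuous into the
functions `[0, ∞) → H` with uniform convergence on compact sets. -/
@[reducible] noncomputable def kSot (H : Type*) [NormedAddCommGroup H] [InnerProductSpace ℂ H] :
    TopologicalSpace (C0Semigroup H) :=
  ⨅ ξ : H, TopologicalSpace.induced
    (fun T : C0Semigroup H => UniformOnFun.ofFun {K : Set ℝ≥0 | IsCompact K} fun t => T t ξ)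
    inferInstance

/-- The topology of uniform weak operator convergence on compact subsets of `[0, ∞)`: the
coarsest one for which, for all `ξ`, `η`, the map `T ↦ (t ↦ ⟨T t ξ, η⟩)` is continuous into the
functions `[0, ∞) → ℂ` with uniform convergence on compact sets.  (Mathlib's inner product is
linear in its second argument.) -/
@[reducible] noncomputable def kWot (H : Type*) [NormedAddCommGroup H] [InnerProductSpace ℂ H] :
    TopologicalSpace (C0Semigroup H) :=
  ⨅ (ξ : H) (η : H), TopologicalSpace.induced
    (fun T : C0Semigroup H =>
      UniformOnFun.ofFun {K : Set ℝ≥0 | IsCompact K} fun t => inner ℂ η (T t ξ))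
    inferInstance

/-- Convergence in `kSot`: for every vector `ξ` and every compact `K`, the supremum over `t ∈ K` of
`‖(S i t - T t) ξ‖` tends to `0`. -/
theorem tendsto_kSot_iff {H : Type*} [NormedAddCommGroup H] [InnerProductSpace ℂ H]
    {ι : Type*} (l : Filter ι) (S : ι → C0Semigroup H) (T : C0Semigroup H) :
    Tendsto S l (@nhds _ (kSot H) T) ↔
      ∀ ξ : H, ∀ K : Set ℝ≥0, IsCompact K → ∀ ε > 0,
        ∀ᶠ i in l, ∀ t ∈ K, ‖(S i t - T t) ξ‖ < ε := by
  simp only [nhds_iInf, nhds_induced, tendsto_iInf, tendsto_comap_iff]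
  refine forall_congr' fun ξ => ?_
  rw [UniformOnFun.tendsto_iff_tendstoUniformlyOn]
  refine forall₂_congr fun K _ => ?_
  rw [Metric.tendstoUniformlyOn_iff]
  simp only [Function.comp_apply, UniformOnFun.toFun_ofFun, dist_eq_norm, norm_sub_rev (T.toFun _ ξ),
    sub_apply]

/-- Convergence in `kWot`: for all vectors `ξ`, `η` and every compact `K`, the supremum over `t ∈ K`
of `|⟨(S i t - T t) ξ, η⟩|` tends to `0`. -/
theorem tendsto_kWot_iff {H : Type*} [NormedAddCommGroup H] [InnerProductSpace ℂ H]
    {ι : Type*} (l : Filter ι) (S : ι → C0Semigroup H) (T : C0Semigroup H) :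
    Tendsto S l (@nhds _ (kWot H) T) ↔
      ∀ ξ η : H, ∀ K : Set ℝ≥0, IsCompact K → ∀ ε > 0,
        ∀ᶠ i in l, ∀ t ∈ K, ‖inner ℂ η ((S i t - T t) ξ)‖ < ε := by
  simp only [nhds_iInf, nhds_induced, tendsto_iInf, tendsto_comap_iff]
  refine forall₂_congr fun ξ η => ?_
  rw [UniformOnFun.tendsto_iff_tendstoUniformlyOn]
  refine forall₂_congr fun K _ => ?_
  rw [Metric.tendstoUniformlyOn_iff]
  simp only [Function.comp_apply, UniformOnFun.toFun_ofFun, dist_eq_norm,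
    norm_sub_rev (inner ℂ η (T.toFun _ ξ)), sub_apply, inner_sub_right]

end C0Semigroup

/-! On unitary semigroups the two topologies agree (`induced_kSot_unitaries`), which settles (i) ↔
(ii). For (ii) ↔ (iii), the unitary semigroups form a dense Gδ in the weakly topologised contractive
ones, and residuality passes both ways between a space and a dense Gδ subspace
(`preimage_mem_residual_iff`). Density rests on Sz.-Nagy dilation: the Toeplitz kernel of a
contractive `T` is positive semidefinite, so completing the space of finitely supported functions on
ℝ gives a separable Hilbert space on which time shifts dilate `T`. On a finite set of vectors, the
embedding of `H` agrees with a unitary map onto that space; pulling the shifts back along it gives a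
unitary semigroup on `H` with the same matrix coefficients on that set. The Gδ property holds
because norms are weakly lower semicontinuous and it suffices to test integer times on a dense
sequence. -/

namespace C0Semigroup

/-! ### Positivity of the Toeplitz kernel -/

variable {H : Type*} [NormedAddCommGroup H] [InnerProductSpace ℂ H]

theorem map_zero_apply (T : C0Semigroup H) (x : H) : T 0 x = x := by
  rw [T.map_zero']; rfl

theorem map_add_apply (T : C0Semigroup H) (s t : ℝ≥0) (x : H) : T (s + t) x = T s (T t x) := by
  rw [T.map_add']; rfl

theorem norm_apply_le {T : C0Semigroup H} (hT : T ∈ contractive H) (t : ℝ≥0) (x : H) :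
    ‖T t x‖ ≤ ‖x‖ := by
  simpa using (T t).le_of_opNorm_le (hT t) x

/-- The Toeplitz kernel of a semigroup, extended to negative times by taking adjoints. -/
noncomputable def toeplitzKernel (T : C0Semigroup H) (s t : ℝ) (x y : H) : ℂ :=
  inner ℂ (T (s - t).toNNReal x) (T (t - s).toNNReal y)

/-- `Real.toNNReal` truncates at 0 and `T 0 = I`, so one side of the kernel is always trivial and a
single formula covers both signs of `t - s`. -/
theorem toeplitzKernel_of_le (T : C0Semigroup H) {s t : ℝ} (h : s ≤ t) (x y : H) :
    T.toeplitzKernel s t x y = inner ℂ x (T (t - s).toNNReal y) := by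
  rw [toeplitzKernel, Real.toNNReal_of_nonpos (sub_nonpos.2 h), map_zero_apply]

theorem toeplitzKernel_of_ge (T : C0Semigroup H) {s t : ℝ} (h : t ≤ s) (x y : H) :
    T.toeplitzKernel s t x y = inner ℂ (T (s - t).toNNReal x) y := by
  rw [toeplitzKernel, Real.toNNReal_of_nonpos (sub_nonpos.2 h), map_zero_apply]

theorem toeplitzKernel_self (T : C0Semigroup H) (s : ℝ) (x y : H) :
    T.toeplitzKernel s s x y = inner ℂ x y := by
  rw [toeplitzKernel_of_le T le_rfl, sub_self, Real.toNNReal_zero, map_zero_apply]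

theorem toeplitzKernel_add_add (T : C0Semigroup H) (s t r : ℝ) (x y : H) :
    T.toeplitzKernel (s + r) (t + r) x y = T.toeplitzKernel s t x y := by
  simp [toeplitzKernel]

theorem conj_toeplitzKernel (T : C0Semigroup H) (s t : ℝ) (x y : H) :
    (starRingEnd ℂ) (T.toeplitzKernel t s y x) = T.toeplitzKernel s t x y :=
  inner_conj_symm _ _

/-- Positivity alone does not survive the induction on the number of times; the square on the left,
based at any earlier time `b`, makes it work by absorbing the cross terms when a new smallest time
is added. -/
theorem norm_sq_le_sum_toeplitzKernel {T : C0Semigroup H} (hT : T ∈ contractive H) (h : ℝ → H)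
    (s : Finset ℝ) (b : ℝ) (hb : ∀ t ∈ s, b ≤ t) :
    ‖∑ t ∈ s, T (t - b).toNNReal (h t)‖ ^ 2 ≤
      (∑ i ∈ s, ∑ j ∈ s, T.toeplitzKernel i j (h i) (h j)).re := by
  induction s using Finset.induction_on_min generalizing b with
  | empty => simp
  | insert a s ha ih =>
    have has : a ∉ s := fun h => lt_irrefl _ (ha a h)
    have hba : b ≤ a := hb a (Finset.mem_insert_self _ _)
    set g := ∑ t ∈ s, T (t - a).toNNReal (h t) with hg
    have key := ih a fun t ht => (ha t ht).le
    have e1 : ∑ t ∈ insert a s, T (t - b).toNNReal (h t) = T (a - b).toNNReal (h a + g) := by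
      rw [Finset.sum_insert has, map_add, hg, map_sum]
      congr 1
      refine Finset.sum_congr rfl fun t ht => ?_
      rw [← map_add_apply, ← Real.toNNReal_add (sub_nonneg.2 hba) (sub_nonneg.2 (ha t ht).le)]
      congr 2
      ring_nf
    have e2 : ∑ j ∈ s, T.toeplitzKernel a j (h a) (h j) = inner ℂ (h a) g := by
      rw [hg, inner_sum]
      exact Finset.sum_congr rfl fun t ht => toeplitzKernel_of_le T (ha t ht).le _ _
    have e3 : ∑ j ∈ s, T.toeplitzKernel j a (h j) (h a) = inner ℂ g (h a) := by
      rw [hg, sum_inner]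
      exact Finset.sum_congr rfl fun t ht => toeplitzKernel_of_ge T (ha t ht).le _ _
    -- The new form is `‖h a‖² + 2 Re⟨h a, g⟩` plus the old one, which is at least `‖g‖²` by `key`.
    have e4 : ‖h a + g‖ ^ 2 ≤ (∑ i ∈ insert a s, ∑ j ∈ insert a s,
        T.toeplitzKernel i j (h i) (h j)).re := by
      rw [@norm_add_sq ℂ, Finset.sum_insert has]
      simp only [Finset.sum_insert has, Finset.sum_add_distrib, e2, e3, toeplitzKernel_self,
        Complex.add_re]
      rw [← inner_conj_symm g (h a), Complex.conj_re]
      have := @inner_self_eq_norm_sq ℂ _ _ _ _ (h a)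
      simp only [RCLike.re_to_complex] at this ⊢
      linarith
    rw [e1]
    refine le_trans ?_ e4
    gcongr
    exact norm_apply_le hT _ _

/-- The sesquilinear form on finitely supported functions defined by the Toeplitz kernel. -/
noncomputable def toeplitzForm (T : C0Semigroup H) (f g : ℝ →₀ H) : ℂ :=
  f.sum fun s x => g.sum fun t y => T.toeplitzKernel s t x y

theorem conj_toeplitzForm (T : C0Semigroup H) (f g : ℝ →₀ H) :
    (starRingEnd ℂ) (T.toeplitzForm g f) = T.toeplitzForm f g := by
  simp only [toeplitzForm, Finsupp.sum, map_sum, conj_toeplitzKernel]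
  exact Finset.sum_comm

theorem re_toeplitzForm_self_nonneg {T : C0Semigroup H} (hT : T ∈ contractive H) (f : ℝ →₀ H) :
    0 ≤ (T.toeplitzForm f f).re := by
  rcases f.support.eq_empty_or_nonempty with hf | hf
  · simp [toeplitzForm, Finsupp.sum, hf]
  · exact le_trans (sq_nonneg _) (norm_sq_le_sum_toeplitzKernel hT f f.support (f.support.min' hf)
      fun t ht => Finset.min'_le _ _ ht)

theorem toeplitzForm_add_left (T : C0Semigroup H) (f g h : ℝ →₀ H) :
    T.toeplitzForm (f + g) h = T.toeplitzForm f h + T.toeplitzForm g h := by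
  refine Finsupp.sum_add_index' (fun s => ?_) fun s x y => ?_
  · simp [toeplitzKernel]
  · simp [toeplitzKernel, Finsupp.sum_add]

theorem toeplitzForm_smul_left (T : C0Semigroup H) (f g : ℝ →₀ H) (c : ℂ) :
    T.toeplitzForm (c • f) g = (starRingEnd ℂ) c * T.toeplitzForm f g := by
  refine (Finsupp.sum_smul_index' fun s => ?_).trans ?_
  · simp [toeplitzKernel]
  · simp only [toeplitzForm, toeplitzKernel, map_smul, inner_smul_left, Finsupp.sum, Finset.mul_sum]

theorem toeplitzForm_single_single (T : C0Semigroup H) (s t : ℝ) (x y : H) :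
    T.toeplitzForm (Finsupp.single s x) (Finsupp.single t y) = T.toeplitzKernel s t x y := by
  rw [toeplitzForm, Finsupp.sum_single_index, Finsupp.sum_single_index] <;> simp [toeplitzKernel]

theorem toeplitzForm_mapDomain_add (T : C0Semigroup H) (r : ℝ) (f g : ℝ →₀ H) :
    T.toeplitzForm (f.mapDomain (· + r)) (g.mapDomain (· + r)) = T.toeplitzForm f g := by
  rw [toeplitzForm, Finsupp.sum_mapDomain_index]
  · refine Finsupp.sum_congr fun s _ => ?_
    rw [Finsupp.sum_mapDomain_index]
    · simp only [toeplitzKernel_add_add]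
    · simp [toeplitzKernel]
    · simp [toeplitzKernel]
  · simp [toeplitzKernel]
  · simp [toeplitzKernel, Finsupp.sum_add]

/-- Finitely supported functions on the real line with values in `H`, to be given the
positive semidefinite form defined by the Toeplitz kernel of `T`. -/
def DilationSpace (T : C0Semigroup H) (_hT : T ∈ contractive H) : Type _ := ℝ →₀ H

/-! ### The pre-Hilbert space of the dilation and its time shifts -/

namespace DilationSpace

variable (T : C0Semigroup H) (hT : T ∈ contractive H)

noncomputable instance : AddCommGroup (DilationSpace T hT) :=
  inferInstanceAs (AddCommGroup (ℝ →₀ H))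

noncomputable instance : Module ℂ (DilationSpace T hT) :=
  inferInstanceAs (Module ℂ (ℝ →₀ H))

/-- The vector `x` placed at time `s`. -/
noncomputable def single (s : ℝ) : H →ₗ[ℂ] DilationSpace T hT := Finsupp.lsingle s

/-- The positive semidefinite form defined by the Toeplitz kernel. -/
noncomputable instance core : PreInnerProductSpace.Core ℂ (DilationSpace T hT) where
  inner := T.toeplitzForm
  conj_inner_symm f g := T.conj_toeplitzForm f g
  re_inner_nonneg f := re_toeplitzForm_self_nonneg hT f
  add_left f g h := T.toeplitzForm_add_left f g h
  smul_left f g c := T.toeplitzForm_smul_left f g c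

/-- The form may be degenerate, so this is only a seminorm; no quotient is taken, since the
completion is separated anyway. -/
noncomputable instance : SeminormedAddCommGroup (DilationSpace T hT) :=
  InnerProductSpace.Core.toSeminormedAddCommGroup (𝕜 := ℂ)

noncomputable instance : InnerProductSpace ℂ (DilationSpace T hT) :=
  InnerProductSpace.ofCore (core T hT)

theorem inner_single_single (s t : ℝ) (x y : H) :
    inner ℂ (single T hT s x) (single T hT t y) = T.toeplitzKernel s t x y :=
  T.toeplitzForm_single_single s t x y

theorem norm_single (s : ℝ) (x : H) : ‖single T hT s x‖ = ‖x‖ := by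
  rw [@norm_eq_sqrt_re_inner ℂ, @norm_eq_sqrt_re_inner ℂ, inner_single_single, toeplitzKernel_self]

theorem span_range_single :
    Submodule.span ℂ (Set.range fun p : ℝ × H => single T hT p.1 p.2) = ⊤ := by
  refine eq_top_iff.2 fun f _ => ?_
  induction f using Finsupp.induction_linear with
  | zero => exact Submodule.zero_mem _
  | add f g hf hg => exact Submodule.add_mem _ (hf trivial) (hg trivial)
  | single s x => exact Submodule.subset_span ⟨(s, x), rfl⟩

theorem continuous_single_left (x : H) : Continuous fun s => single T hT s x := by
  refine continuous_iff_continuousAt.2 fun t => ?_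
  rw [ContinuousAt, tendsto_iff_norm_sub_tendsto_zero]
  have h1 : ∀ s, ‖single T hT s x - single T hT t x‖ =
      √(2 * ‖x‖ ^ 2 - 2 * (T.toeplitzKernel s t x x).re) := fun s => by
    rw [← Real.sqrt_sq (norm_nonneg (single T hT s x - single T hT t x)), @norm_sub_sq ℂ,
      norm_single, norm_single, inner_single_single]
    congr 1
    simp only [RCLike.re_to_complex]
    ring
  simp only [h1]
  have h2 : Continuous fun s : ℝ => √(2 * ‖x‖ ^ 2 - 2 * (T.toeplitzKernel s t x x).re) := by
    have h3 : Continuous fun s : ℝ => T (s - t).toNNReal x :=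
      (T.sot_continuous' x).comp (by fun_prop)
    have h4 : Continuous fun s : ℝ => T (t - s).toNNReal x :=
      (T.sot_continuous' x).comp (by fun_prop)
    exact ((continuous_const.sub (continuous_const.mul
      (Complex.continuous_re.comp (h3.inner h4))))).sqrt
  have h5 := h2.tendsto t
  rwa [toeplitzKernel_self, inner_self_eq_norm_sq_to_K, ← RCLike.ofReal_pow, ← RCLike.re_to_complex, RCLike.ofReal_re,
    sub_self, Real.sqrt_zero] at h5

theorem continuous_single : Continuous fun p : ℝ × H => single T hT p.1 p.2 :=
  continuous_prod_of_continuous_lipschitzWith' _ 1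
    (fun s => (AddMonoidHomClass.isometry_of_norm (single T hT s) (norm_single T hT s)).lipschitz)
    (continuous_single_left T hT)

/-- The generators are a continuous image of the separable space `ℝ × H`. Separability is what later
makes the dilation space isomorphic to `H`. -/
instance [TopologicalSpace.SeparableSpace H] :
    TopologicalSpace.SeparableSpace (DilationSpace T hT) := by
  rw [← TopologicalSpace.isSeparable_univ_iff, ← Submodule.top_coe (R := ℂ),
    ← span_range_single T hT]
  exact (TopologicalSpace.isSeparable_range (continuous_single T hT)).span

/-- Translation of time on the dilation space. -/
noncomputable def shift (r : ℝ) : DilationSpace T hT →ₗᵢ[ℂ] DilationSpace T hT where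
  toLinearMap := Finsupp.lmapDomain H ℂ (· + r)
  norm_map' f := by
    rw [@norm_eq_sqrt_re_inner ℂ, @norm_eq_sqrt_re_inner ℂ]
    exact congrArg (fun z : ℂ => √z.re) (T.toeplitzForm_mapDomain_add r f f)

theorem shift_single (r s : ℝ) (x : H) : shift T hT r (single T hT s x) = single T hT (s + r) x :=
  Finsupp.mapDomain_single

theorem shift_zero (f : DilationSpace T hT) : shift T hT 0 f = f := by
  refine Eq.trans ?_ (Finsupp.mapDomain_id (v := (f : ℝ →₀ H)))
  exact congrArg (fun u : ℝ → ℝ => Finsupp.mapDomain u (f : ℝ →₀ H)) (funext add_zero)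

theorem shift_add (r s : ℝ) (f : DilationSpace T hT) :
    shift T hT (r + s) f = shift T hT r (shift T hT s f) := by
  refine Eq.trans ?_ (Finsupp.mapDomain_comp (v := (f : ℝ →₀ H)))
  exact congrArg (fun u : ℝ → ℝ => Finsupp.mapDomain u (f : ℝ →₀ H))
    (funext fun x => by simp [add_comm r s, add_assoc])

theorem continuous_shift (f : DilationSpace T hT) : Continuous fun r => shift T hT r f := by
  have hf : f ∈ Submodule.span ℂ (Set.range fun p : ℝ × H => single T hT p.1 p.2) :=
    span_range_single T hT ▸ Submodule.mem_top
  induction hf using Submodule.span_induction with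
  | mem f hf =>
    obtain ⟨⟨s, x⟩, rfl⟩ := hf
    simp only [shift_single]
    exact (continuous_single_left T hT x).comp (continuous_const.add continuous_id)
  | zero => simpa using continuous_const
  | add f g _ _ hf hg => simpa only [map_add] using! hf.add hg
  | smul c f _ hf => simpa only [map_smul] using! hf.const_smul c

end DilationSpace
end C0Semigroup

/-! ### Replacing an isometry by a unitary on finitely many vectors -/

theorem Orthonormal.countable_of_separableSpace {ι E : Type*} [NormedAddCommGroup E]
    [InnerProductSpace ℂ E] [TopologicalSpace.SeparableSpace E] {v : ι → E}
    (hv : Orthonormal ℂ v) : Countable ι := by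
  refine Pairwise.countable_of_isOpen_disjoint (s := fun i => Metric.ball (v i) (1 / 2)) ?_
    (fun _ => Metric.isOpen_ball) fun i => Metric.nonempty_ball.2 (by norm_num)
  intro i j hij
  refine Metric.ball_disjoint_ball ?_
  -- Distinct vectors are √2 > 1 apart, so balls of radius 1/2 are disjoint.
  have h1 : ‖v i - v j‖ ^ 2 = 2 := by
    rw [@norm_sub_sq ℂ, hv.2 hij, hv.1, hv.1]
    norm_num
  rw [dist_eq_norm]
  nlinarith [norm_nonneg (v i - v j)]

theorem HilbertBasis.infinite_of_not_finiteDimensional {ι E : Type*} [NormedAddCommGroup E]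
    [InnerProductSpace ℂ E] (hE : ¬ FiniteDimensional ℂ E) (b : HilbertBasis ι ℂ E) :
    Infinite ι := by
  by_contra h
  rw [not_infinite_iff_finite] at h
  have := Fintype.ofFinite ι
  exact hE b.toOrthonormalBasis.toBasis.finiteDimensional_of_finite

/-- An orthonormal basis of the span of `F` and its image under `J` both extend to countably
infinite Hilbert bases. Only finitely many vectors are prescribed, so the remaining ones can be
matched by any bijection, even if `J` is far from surjective. -/
theorem LinearIsometry.exists_linearIsometryEquiv_eqOn_finset {H K : Type*}
    [NormedAddCommGroup H] [InnerProductSpace ℂ H] [CompleteSpace H]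
    [TopologicalSpace.SeparableSpace H] [NormedAddCommGroup K] [InnerProductSpace ℂ K]
    [CompleteSpace K] [TopologicalSpace.SeparableSpace K] (hH : ¬ FiniteDimensional ℂ H)
    (J : H →ₗᵢ[ℂ] K) (F : Finset H) : ∃ W : H ≃ₗᵢ[ℂ] K, ∀ x ∈ F, W x = J x := by
  classical
  have hK : ¬ FiniteDimensional ℂ K := fun _ =>
    hH (FiniteDimensional.of_injective J.toLinearMap J.injective)
  let M : Submodule ℂ H := Submodule.span ℂ (F : Set H)
  have : FiniteDimensional ℂ M := FiniteDimensional.span_finset ℂ F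
  let e := stdOrthonormalBasis ℂ M
  have hv : Orthonormal ℂ fun i => (e i : H) := e.orthonormal.comp_linearIsometry M.subtypeₗᵢ
  let u : Set H := Set.range fun i => (e i : H)
  have hJu : J '' u = Set.range fun i => J (e i : H) := (Set.range_comp J _).symm
  have huf : u.Finite := Set.finite_range _
  obtain ⟨w, b, huw, hb⟩ := hv.toSubtypeRange.exists_hilbertBasis_extension
  change u ⊆ w at huw
  have hu' : Orthonormal ℂ ((↑) : (J '' u) → K) := by
    rw [hJu]
    exact (hv.comp_linearIsometry J).toSubtypeRange
  obtain ⟨w', b', huw', hb'⟩ := hu'.exists_hilbertBasis_extension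
  have hwc : w.Countable := b.orthonormal.countable_of_separableSpace
  have hwc' : w'.Countable := b'.orthonormal.countable_of_separableSpace
  have hwi : w.Infinite := Set.infinite_coe_iff.1 (b.infinite_of_not_finiteDimensional hH)
  have hwi' : w'.Infinite := Set.infinite_coe_iff.1 (b'.infinite_of_not_finiteDimensional hK)
  have : Countable ↥(w \ u) := (hwc.mono Set.sdiff_subset).to_subtype
  have : Countable ↥(w' \ J '' u) := (hwc'.mono Set.sdiff_subset).to_subtype
  have : Infinite ↥(w \ u) := (hwi.sdiff huf).to_subtype
  have : Infinite ↥(w' \ J '' u) := (hwi'.sdiff (huf.image J)).to_subtype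
  obtain ⟨ψ⟩ : Nonempty (↥(w \ u) ≃ ↥(w' \ J '' u)) := nonempty_equiv_of_countable
  let φ : w ≃ w' := (Equiv.Set.sumDiffSubset huw).symm.trans
    (((Equiv.Set.image J u J.injective).sumCongr ψ).trans (Equiv.Set.sumDiffSubset huw'))
  have hφ : ∀ x (hx : x ∈ u), (φ ⟨x, huw hx⟩ : K) = J x := fun x hx => by
    simp [φ, Equiv.Set.sumDiffSubset_symm_apply_of_mem huw (x := ⟨x, huw hx⟩) hx]
  have ho : Orthonormal ℂ fun i => b' (φ i) := b'.orthonormal.comp φ φ.injective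
  let b'' : HilbertBasis w ℂ K := HilbertBasis.mk ho (by
    rw [show (fun i => b' (φ i)) = b' ∘ φ from rfl, φ.surjective.range_comp, b'.dense_span])
  let W : H ≃ₗᵢ[ℂ] K := b.repr.trans b''.repr.symm
  have hW : ∀ i, W (b i) = b' (φ i) := fun i => by
    simp only [W, LinearIsometryEquiv.trans_apply, HilbertBasis.repr_self,
      HilbertBasis.repr_symm_single]
    exact congrFun (HilbertBasis.coe_mk ho _) i
  have hWu : ∀ i, W (e i : H) = J (e i : H) := fun i => by
    have h1 := hW ⟨e i, huw ⟨i, rfl⟩⟩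
    rwa [hb, hb', hφ _ ⟨i, rfl⟩] at h1
  have hWM : W.toLinearEquiv.toLinearMap ∘ₗ M.subtype = J.toLinearMap ∘ₗ M.subtype :=
    e.toBasis.ext fun i => by simpa using hWu i
  exact ⟨W, fun x hx => LinearMap.congr_fun hWM ⟨x, Submodule.subset_span hx⟩⟩

theorem LinearIsometryEquiv.mem_unitary {E : Type*} [NormedAddCommGroup E]
    [InnerProductSpace ℂ E] [CompleteSpace E] (e : E ≃ₗᵢ[ℂ] E) :
    (e : E →L[ℂ] E) ∈ unitary (E →L[ℂ] E) :=
  (Unitary.linearIsometryEquiv.symm e).2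

theorem ContinuousLinearMap.mem_unitary_of_norm_map {E : Type*} [NormedAddCommGroup E]
    [InnerProductSpace ℂ E] [CompleteSpace E] {u v : E →L[ℂ] E} (hu : ∀ x, ‖u x‖ = ‖x‖)
    (huv : ∀ x, u (v x) = x) : u ∈ unitary (E →L[ℂ] E) := by
  have h1 : star u * u = 1 := u.norm_map_iff_adjoint_comp_self.1 hu
  have h2 : u * v = 1 := ContinuousLinearMap.ext huv
  have h3 : star u = v := left_inv_eq_right_inv h1 h2
  exact Unitary.mem_iff.2 ⟨h1, h3 ▸ h2⟩

namespace C0Semigroup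

/-- Transport of a semigroup along an isometric isomorphism. -/
noncomputable def conj {H K : Type*} [NormedAddCommGroup H] [InnerProductSpace ℂ H]
    [NormedAddCommGroup K] [InnerProductSpace ℂ K] (W : H ≃ₗᵢ[ℂ] K) (S : C0Semigroup K) :
    C0Semigroup H where
  toFun t := (W.symm : K →L[ℂ] H) ∘L S t ∘L (W : H →L[ℂ] K)
  map_zero' := by ext x; simp [S.map_zero']
  map_add' s t := by ext x; simp [S.map_add']
  sot_continuous' x := W.symm.continuous.comp (S.sot_continuous' (W x))

theorem conj_mem_unitaries {H K : Type*} [NormedAddCommGroup H] [InnerProductSpace ℂ H]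
    [CompleteSpace H] [NormedAddCommGroup K] [InnerProductSpace ℂ K] [CompleteSpace K]
    (W : H ≃ₗᵢ[ℂ] K) {S : C0Semigroup K} (hS : S ∈ unitaries K) : S.conj W ∈ unitaries H :=
  fun t => ((W.trans (Unitary.linearIsometryEquiv ⟨S t, hS t⟩)).trans W.symm).mem_unitary

theorem inner_conj_apply {H K : Type*} [NormedAddCommGroup H] [InnerProductSpace ℂ H]
    [NormedAddCommGroup K] [InnerProductSpace ℂ K] (W : H ≃ₗᵢ[ℂ] K) (S : C0Semigroup K)
    (t : ℝ≥0) (x y : H) : inner ℂ x (S.conj W t y) = inner ℂ (W x) (S t (W y)) := by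
  rw [← W.inner_map_map]
  simp [conj]

/-! ### The unitary dilation -/

section Dilation

open UniformSpace DilationSpace

variable {H : Type*} [NormedAddCommGroup H] [InnerProductSpace ℂ H]
  (T : C0Semigroup H) (hT : T ∈ contractive H)

/-- Translation of time on the completed dilation space. -/
noncomputable def completionShift (r : ℝ) :
    Completion (DilationSpace T hT) →L[ℂ] Completion (DilationSpace T hT) :=
  (shift T hT r).toContinuousLinearMap.completion

theorem completionShift_coe (r : ℝ) (f : DilationSpace T hT) :
    completionShift T hT r f = (shift T hT r f : Completion (DilationSpace T hT)) :=
  ContinuousLinearMap.completion_apply_coe _ f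

theorem norm_completionShift (r : ℝ) (f : Completion (DilationSpace T hT)) :
    ‖completionShift T hT r f‖ = ‖f‖ := by
  induction f using Completion.induction_on with
  | hp => exact isClosed_eq (completionShift T hT r).continuous.norm continuous_norm
  | ih f => simp [completionShift_coe]

theorem completionShift_zero (f : Completion (DilationSpace T hT)) :
    completionShift T hT 0 f = f := by
  induction f using Completion.induction_on with
  | hp => exact isClosed_eq (completionShift T hT 0).continuous continuous_id
  | ih f => rw [completionShift_coe, shift_zero]

theorem completionShift_add (r s : ℝ) (f : Completion (DilationSpace T hT)) :
    completionShift T hT (r + s) f = completionShift T hT r (completionShift T hT s f) := by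
  induction f using Completion.induction_on with
  | hp =>
    exact isClosed_eq (completionShift T hT _).continuous
      ((completionShift T hT r).continuous.comp (completionShift T hT s).continuous)
  | ih f => rw [completionShift_coe, completionShift_coe, completionShift_coe, shift_add]

/-- The shifts are isometries, so approximating `f` by `g` approximates the whole orbit uniformly in
`r`. -/
theorem continuous_completionShift (f : Completion (DilationSpace T hT)) :
    Continuous fun r => completionShift T hT r f := by
  refine continuous_of_uniform_approx_of_continuous fun V hV => ?_
  obtain ⟨ε, hε, hεV⟩ := Metric.mem_uniformity_dist.1 hV
  obtain ⟨g, hg⟩ := Metric.denseRange_iff.1 (Completion.denseRange_coe (α := DilationSpace T hT))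
    f ε hε
  refine ⟨fun r => completionShift T hT r g, ?_, fun r => hεV ?_⟩
  · simp only [completionShift_coe]
    exact (Completion.continuous_coe _).comp (continuous_shift T hT g)
  · rwa [dist_eq_norm, ← map_sub, norm_completionShift, ← dist_eq_norm]

/-- The unitary dilation of a contractive semigroup. -/
noncomputable def dilation : C0Semigroup (Completion (DilationSpace T hT)) where
  toFun t := completionShift T hT t
  map_zero' := ContinuousLinearMap.ext fun f => completionShift_zero T hT f
  map_add' s t := ContinuousLinearMap.ext fun f => by
    rw [NNReal.coe_add]
    exact completionShift_add T hT s t f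
  sot_continuous' f := (continuous_completionShift T hT f).comp NNReal.continuous_coe

theorem dilation_mem_unitaries : T.dilation hT ∈ unitaries (Completion (DilationSpace T hT)) :=
  fun t => ContinuousLinearMap.mem_unitary_of_norm_map (norm_completionShift T hT t) fun f =>
    (completionShift_add T hT t (-t) f).symm.trans (by
      rw [add_neg_cancel, completionShift_zero])

/-- The isometric embedding of a Hilbert space into the dilation space, at time zero. -/
noncomputable def dilationEmbedding : H →ₗᵢ[ℂ] Completion (DilationSpace T hT) :=
  Completion.toComplₗᵢ.comp ⟨single T hT 0, norm_single T hT 0⟩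

theorem inner_dilation (t : ℝ≥0) (x y : H) :
    inner ℂ (T.dilationEmbedding hT x) (T.dilation hT t (T.dilationEmbedding hT y)) =
      inner ℂ x (T t y) := by
  change inner ℂ (single T hT 0 x : Completion (DilationSpace T hT))
    (completionShift T hT t (single T hT 0 y : Completion (DilationSpace T hT))) = _
  rw [completionShift_coe, Completion.inner_coe, shift_single, inner_single_single,
    toeplitzKernel_of_le T (by simp)]
  simp

end Dilation

/-! ### Weak density of the unitary semigroups -/

section Density

variable {H : Type*} [NormedAddCommGroup H] [InnerProductSpace ℂ H] [CompleteSpace H]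
  [TopologicalSpace.SeparableSpace H]

theorem exists_unitaries_inner_eq (hH : ¬ FiniteDimensional ℂ H) {T : C0Semigroup H}
    (hT : T ∈ contractive H) (F : Finset H) :
    ∃ S ∈ unitaries H, ∀ x ∈ F, ∀ y ∈ F, ∀ t, inner ℂ x (S t y) = inner ℂ x (T t y) := by
  obtain ⟨W, hW⟩ := (T.dilationEmbedding hT).exists_linearIsometryEquiv_eqOn_finset hH F
  refine ⟨(T.dilation hT).conj W, conj_mem_unitaries W (T.dilation_mem_unitaries hT),
    fun x hx y hy t => ?_⟩
  rw [inner_conj_apply, hW x hx, hW y hy, inner_dilation]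

theorem contractive_subset_closure_unitaries (hH : ¬ FiniteDimensional ℂ H) :
    contractive H ⊆ @closure _ (kWot H) (unitaries H) := by
  classical
  intro T hT
  choose S hS hST using exists_unitaries_inner_eq hH hT
  let _ := kWot H
  refine mem_closure_of_tendsto (f := S) (b := atTop) ?_ (Eventually.of_forall hS)
  rw [tendsto_kWot_iff]
  intro ξ η K _ ε hε
  -- Along the net of finite sets, the coefficient at `ξ`, `η` is exactly that of `T`, at all times,
  -- once both vectors belong to `F`.
  filter_upwards [eventually_ge_atTop ({ξ, η} : Finset H)] with F hF t _
  rw [sub_apply, inner_sub_right, hST F η (hF (by simp)) ξ (hF (by simp)) t, sub_self]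
  simpa using hε

end Density

end C0Semigroup

/-! ### Residual sets in a dense Gδ subspace -/

/-- Dense open sets of the subspace extend to open sets that are dense because the range is;
intersecting these with the range, itself residual, returns to the subspace. Conversely, a dense
open set meets the dense range in a dense subset. -/
theorem Topology.IsInducing.preimage_mem_residual_iff {X Y : Type*} [TopologicalSpace X]
    [TopologicalSpace Y] {f : X → Y} (hf : IsInducing f) (hd : DenseRange f)
    (hG : IsGδ (Set.range f)) {s : Set Y} : f ⁻¹' s ∈ residual X ↔ s ∈ residual Y := by
  constructor
  · intro h
    obtain ⟨S, hSo, hSd, hSc, hSs⟩ := mem_residual_iff.1 h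
    choose! O hO hOt using fun t ht => hf.isOpen_iff.1 (hSo t ht)
    have h1 : (⋂ t ∈ S, O t) ∈ residual Y := by
      refine (countable_bInter_mem hSc).2 fun t ht => residual_of_dense_open (hO t ht) ?_
      refine (hd.dense_image hf.continuous (hSd t ht)).mono ?_
      rw [Set.image_subset_iff, hOt t ht]
    filter_upwards [h1, residual_of_dense_Gδ hG hd]
    rintro _ hx ⟨z, rfl⟩
    refine hSs fun t ht => ?_
    rw [← hOt t ht]
    exact Set.mem_iInter₂.1 hx t ht
  · intro h
    obtain ⟨S, hSo, hSd, hSc, hSs⟩ := mem_residual_iff.1 h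
    have h1 : (⋂ t ∈ S, f ⁻¹' t) ∈ residual X := by
      refine (countable_bInter_mem hSc).2 fun t ht =>
        residual_of_dense_open ((hSo t ht).preimage hf.continuous) fun x => ?_
      rw [hf.closure_eq_preimage_closure_image, Set.image_preimage_eq_inter_range,
        Set.mem_preimage]
      exact (hSd t ht).inter_of_isOpen_left hd (hSo t ht) (f x)
    filter_upwards [h1] with x hx
    exact hSs fun t ht => Set.mem_iInter₂.1 hx t ht

/-! ### The unitary semigroups form a Gδ set -/

/-- Weak lower semicontinuity: the norm is the supremum of `‖⟨y, ·⟩‖` over the unit ball. -/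
theorem isOpen_lt_norm {X E : Type*} [TopologicalSpace X] [NormedAddCommGroup E]
    [InnerProductSpace ℂ E] {f : X → E} (hf : ∀ y, Continuous fun x => (inner ℂ y (f x) : ℂ))
    (c : ℝ) : IsOpen {x | c < ‖f x‖} := by
  have h : {x | c < ‖f x‖} = ⋃ y ∈ Metric.closedBall (0 : E) 1, {x | c < ‖inner ℂ y (f x)‖} := by
    ext x
    simp only [Set.mem_iUnion, Set.mem_ofPred_eq, mem_closedBall_zero_iff, exists_prop]
    constructor
    · intro hx
      -- The normalised vector attains the supremum; if `f x = 0`, it is 0 by the convention `0⁻¹ =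
      -- 0`, which also works.
      refine ⟨((‖f x‖ : ℂ)⁻¹) • f x, ?_, ?_⟩
      · rw [norm_smul, norm_inv, Complex.norm_real, norm_norm]
        exact inv_mul_le_one
      · rcases eq_or_ne (f x) 0 with h0 | h0
        · simpa [h0] using hx
        · have h1 : (‖f x‖ : ℂ) ≠ 0 := by simpa using h0
          rw [inner_smul_left, inner_self_eq_norm_sq_to_K]
          simpa [pow_two, h0] using hx
    · rintro ⟨y, hy, hxy⟩
      refine hxy.trans_le ((norm_inner_le_norm _ _).trans ?_)
      exact mul_le_of_le_one_left (norm_nonneg _) hy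
  rw [h]
  exact isOpen_biUnion fun y _ => isOpen_lt continuous_const (hf y).norm

theorem ContinuousLinearMap.le_norm_map_of_denseRange {E : Type*} [NormedAddCommGroup E]
    [InnerProductSpace ℂ E] {A : E →L[ℂ] E} {v : ℕ → E} (hv : DenseRange v)
    (h : ∀ k m : ℕ, ‖v k‖ - 1 / (m + 1 : ℝ) < ‖A (v k)‖) (x : E) : ‖x‖ ≤ ‖A x‖ := by
  refine hv.induction_on (p := fun x => ‖x‖ ≤ ‖A x‖) x
    (isClosed_le continuous_norm A.continuous.norm) fun k => ?_
  refine le_of_forall_pos_le_add fun ε hε => ?_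
  obtain ⟨m, hm⟩ := exists_nat_one_div_lt hε
  linarith [h k m]

theorem ContinuousLinearMap.mem_unitary_of_norm_le {E : Type*} [NormedAddCommGroup E]
    [InnerProductSpace ℂ E] [CompleteSpace E] {A : E →L[ℂ] E} (hA : ‖A‖ ≤ 1)
    (h1 : ∀ x, ‖x‖ ≤ ‖A x‖) (h2 : ∀ x, ‖x‖ ≤ ‖star A x‖) : A ∈ unitary (E →L[ℂ] E) := by
  have hA' : ‖star A‖ ≤ 1 := (norm_star A).trans_le hA
  refine Unitary.mem_iff.2 ⟨A.norm_map_iff_adjoint_comp_self.1 fun x => le_antisymm ?_ (h1 x), ?_⟩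
  · simpa using A.le_of_opNorm_le hA x
  · have := (star A).norm_map_iff_adjoint_comp_self.1 fun x => le_antisymm
      (by simpa using (star A).le_of_opNorm_le hA' x) (h2 x)
    rwa [← star_eq_adjoint, star_star] at this

namespace C0Semigroup

variable {H : Type*} [NormedAddCommGroup H] [InnerProductSpace ℂ H]

theorem continuous_kWot_inner (t : ℝ≥0) (x y : H) :
    @Continuous _ _ (kWot H) _ fun T : C0Semigroup H => (inner ℂ y (T t x) : ℂ) := by
  let _ := kWot H
  refine continuous_iff_continuousAt.2 fun T => ?_
  rw [ContinuousAt, tendsto_iff_norm_sub_tendsto_zero, Metric.tendsto_nhds]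
  intro ε hε
  filter_upwards [(tendsto_kWot_iff _ _ T).1 tendsto_id x y {t} isCompact_singleton ε hε] with S hS
  simpa [inner_sub_right] using hS t rfl

variable [CompleteSpace H]

theorem unitaries_subset_contractive : unitaries H ⊆ contractive H := fun T hT t =>
  (T t).opNorm_le_bound zero_le_one fun x => by
    rw [one_mul, (T t).norm_map_of_mem_unitary (hT t)]

theorem mem_unitaries_iff_of_contractive {v : ℕ → H} (hv : DenseRange v) {T : C0Semigroup H}
    (hT : T ∈ contractive H) :
    T ∈ unitaries H ↔ ∀ n k m : ℕ, ‖v k‖ - 1 / (m + 1 : ℝ) < ‖T n (v k)‖ ∧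
      ‖v k‖ - 1 / (m + 1 : ℝ) < ‖star (T n) (v k)‖ := by
  constructor
  · intro h n k m
    have hm : 0 < 1 / (m + 1 : ℝ) := by positivity
    rw [(T n).norm_map_of_mem_unitary (h n),
      (star (T n)).norm_map_of_mem_unitary (Unitary.star_mem (h n))]
    constructor <;> linarith
  · intro h t
    -- Integer times suffice: with `n = t + r`, `T n` factors as `T r` after `T t`, and its adjoint
    -- as `star (T r)` after `star (T t)`. The outer factors are contractions, so lower norm bounds
    -- pass from `n` to `t`.
    obtain ⟨n, hn⟩ := exists_nat_ge t
    obtain ⟨r, hr⟩ := exists_add_of_le hn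
    have hs : ∀ s x, ‖star (T s) x‖ ≤ ‖x‖ := fun s x => by
      simpa using (star (T s)).le_of_opNorm_le ((norm_star _).trans_le (hT s)) x
    refine ContinuousLinearMap.mem_unitary_of_norm_le (hT t) (fun x => ?_) fun x => ?_
    · refine (ContinuousLinearMap.le_norm_map_of_denseRange hv (fun k m => (h n k m).1) x).trans ?_
      rw [hr, add_comm, map_add_apply]
      exact norm_apply_le hT _ _
    · refine (ContinuousLinearMap.le_norm_map_of_denseRange hv (fun k m => (h n k m).2) x).trans ?_
      rw [hr, T.map_add', ← ContinuousLinearMap.mul_def, star_mul]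
      exact hs _ _

theorem isGδ_unitaries [TopologicalSpace.SeparableSpace H] :
    @IsGδ (contractive H) (TopologicalSpace.induced Subtype.val (kWot H))
      {T | (T : C0Semigroup H) ∈ unitaries H} := by
  let _ := TopologicalSpace.induced (Subtype.val : contractive H → _) (kWot H)
  have hv := TopologicalSpace.denseRange_denseSeq H
  set v := TopologicalSpace.denseSeq H
  have hc : ∀ t x y, Continuous fun T : contractive H => (inner ℂ y (T.1 t x) : ℂ) :=
    fun t x y => @Continuous.comp _ _ _ _ (kWot H) _ _ _ (continuous_kWot_inner t x y)
      continuous_induced_dom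
  have h : {T : contractive H | (T : C0Semigroup H) ∈ unitaries H} = ⋂ (n : ℕ) (k : ℕ) (m : ℕ),
      ({T : contractive H | ‖v k‖ - 1 / (m + 1 : ℝ) < ‖T.1 n (v k)‖} ∩
        {T : contractive H | ‖v k‖ - 1 / (m + 1 : ℝ) < ‖star (T.1 n) (v k)‖}) := by
    ext T
    simp only [Set.mem_iInter, Set.mem_inter_iff, Set.mem_ofPred_eq]
    exact mem_unitaries_iff_of_contractive hv T.2
  rw [h]
  refine .iInter fun n => .iInter fun k => .iInter fun m => IsOpen.isGδ <| .inter ?_ ?_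
  · exact isOpen_lt_norm (fun y => hc n (v k) y) _
  · refine isOpen_lt_norm (fun y => ?_) _
    -- Coefficients of the adjoint are conjugates of coefficients of `T n`, hence also weakly
    -- continuous.
    simp only [ContinuousLinearMap.star_eq_adjoint, ContinuousLinearMap.adjoint_inner_right]
    simp only [← inner_conj_symm (_ : H) (v k)]
    exact Complex.continuous_conj.comp (hc n y (v k))

/-! ### Comparison of the two topologies -/

omit [CompleteSpace H] in
theorem kSot_le_kWot : kSot H ≤ kWot H := by
  refine le_of_nhds_le_nhds fun T => ?_
  have h := (tendsto_kSot_iff (@nhds _ (kSot H) T) id T).1 tendsto_id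
  refine (tendsto_kWot_iff (@nhds _ (kSot H) T) id T).2 fun ξ η K hK ε hε => ?_
  filter_upwards [h ξ K hK (ε / (‖η‖ + 1)) (by positivity)] with S hS t ht
  have h1 := (lt_div_iff₀ (by positivity)).1 (hS t ht)
  refine (norm_inner_le_norm _ _).trans_lt (lt_of_le_of_lt ?_ h1)
  rw [mul_comm]
  gcongr
  linarith

/-- Since `‖S t ξ‖ = ‖T t ξ‖`, the squared distance is `-2 Re⟨T t ξ, S t ξ - T t ξ⟩`. Here `T t ξ`
moves with `t`, but the orbit over the compact set `K` is totally bounded, so finitely many fixed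
vectors `η` suffice. -/
theorem induced_kSot_unitaries :
    TopologicalSpace.induced (Subtype.val : unitaries H → _) (kSot H) =
      TopologicalSpace.induced Subtype.val (kWot H) := by
  refine le_antisymm (induced_mono kSot_le_kWot) (le_of_nhds_le_nhds fun T => ?_)
  rw [@nhds_induced _ _ (kSot H), ← tendsto_iff_comap, tendsto_kSot_iff]
  have h := (tendsto_kWot_iff _ Subtype.val T.1).1
    (@Continuous.tendsto _ _ (TopologicalSpace.induced (Subtype.val : unitaries H → _) (kWot H))
      (kWot H) _ continuous_induced_dom T)
  intro ξ K hK ε hε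
  -- As `‖a - b‖ ≤ 2 (‖ξ‖ + 1)`, replacing `b` by `η` costs at most `2 · ε²/4`; the weak estimate
  -- costs at most `2 · ε²/8`. The total, `3ε²/4`, is below `ε²`.
  have hδ : 0 < ε ^ 2 / (8 * (‖ξ‖ + 1)) := by positivity
  obtain ⟨F, hF, hKF⟩ := Metric.totallyBounded_iff.1
    (hK.image (T.1.sot_continuous' ξ)).totallyBounded _ hδ
  have h2 := (eventually_all_finite hF).2 fun η _ => h ξ η K hK (ε ^ 2 / 8) (by positivity)
  filter_upwards [h2] with S hS t ht
  obtain ⟨η, hη, hd⟩ := Set.mem_iUnion₂.1 (hKF ⟨t, ht, rfl⟩)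
  have h3 := hS η hη t ht
  have hn1 : ‖S.1 t ξ‖ = ‖ξ‖ := (S.1 t).norm_map_of_mem_unitary (S.2 t) ξ
  have hn2 : ‖T.1 t ξ‖ = ‖ξ‖ := (T.1 t).norm_map_of_mem_unitary (T.2 t) ξ
  rw [Metric.mem_ball, dist_eq_norm] at hd
  rw [sub_apply] at h3 ⊢
  set a := S.1 t ξ
  set b := T.1 t ξ
  have h4 : ‖a - b‖ ^ 2 = -2 * (inner ℂ η (a - b)).re - 2 * (inner ℂ (b - η) (a - b)).re := by
    have h5 : inner ℂ η (a - b) = inner ℂ b (a - b) - inner ℂ (b - η) (a - b) := by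
      rw [inner_sub_left]; ring
    have h6 := @inner_self_eq_norm_sq ℂ _ _ _ _ b
    have h7 := @norm_sub_sq ℂ _ _ _ _ a b
    have h8 : (inner ℂ a b).re = (inner ℂ b a).re := by
      rw [← inner_conj_symm, Complex.conj_re]
    simp only [RCLike.re_to_complex] at h6 h7
    rw [h5, Complex.sub_re, inner_sub_right b, Complex.sub_re, h6, h7, h8, hn1, hn2]
    ring
  have h9 : ‖inner ℂ (b - η) (a - b)‖ ≤ ε ^ 2 / 4 := by
    refine (norm_inner_le_norm _ _).trans ?_
    have h10 : ‖a - b‖ ≤ 2 * (‖ξ‖ + 1) := (norm_sub_le _ _).trans (by linarith)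
    calc ‖b - η‖ * ‖a - b‖ ≤ ε ^ 2 / (8 * (‖ξ‖ + 1)) * (2 * (‖ξ‖ + 1)) := by gcongr
      _ = ε ^ 2 / 4 := by field_simp; norm_num
  have h11 := (abs_le.1 ((Complex.abs_re_le_norm (inner ℂ η (a - b))).trans h3.le)).1
  have h12 := (abs_le.1 ((Complex.abs_re_le_norm (inner ℂ (b - η) (a - b))).trans h9)).1
  refine lt_of_pow_lt_pow_left₀ 2 hε.le ?_
  have : 0 < ε ^ 2 := by positivity
  linarith

end C0Semigroup

theorem mainTheorem4 (H : Type*) [NormedAddCommGroup H] [InnerProductSpace ℂ H] [CompleteSpace H]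
    [TopologicalSpace.SeparableSpace H] (hH : ¬ FiniteDimensional ℂ H)
    (Φ : C0Semigroup H → Prop) :
    List.TFAE
      [{T : C0Semigroup.unitaries H | Φ T} ∈
          @residual (C0Semigroup.unitaries H)
            (TopologicalSpace.induced Subtype.val (C0Semigroup.kSot H)),
        {T : C0Semigroup.unitaries H | Φ T} ∈
          @residual (C0Semigroup.unitaries H)
            (TopologicalSpace.induced Subtype.val (C0Semigroup.kWot H)),
        {T : C0Semigroup.contractive H | Φ T} ∈
          @residual (C0Semigroup.contractive H)
            (TopologicalSpace.induced Subtype.val (C0Semigroup.kWot H))] := by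
  rw [C0Semigroup.induced_kSot_unitaries]
  let _ := C0Semigroup.kWot H
  let f : C0Semigroup.unitaries H → C0Semigroup.contractive H :=
    Set.inclusion C0Semigroup.unitaries_subset_contractive
  have hf : IsInducing f := (Topology.IsEmbedding.inclusion _).isInducing
  have hr : Set.range f = {T : C0Semigroup.contractive H | (T : C0Semigroup H) ∈ C0Semigroup.unitaries H} :=
    Set.range_inclusion _
  have hd : DenseRange f := by
    rw [DenseRange, hr, Subtype.dense_iff]
    change _ ⊆ closure (Subtype.val '' (Subtype.val ⁻¹' C0Semigroup.unitaries H))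
    rw [Subtype.image_preimage_coe, Set.inter_eq_self_of_subset_right C0Semigroup.unitaries_subset_contractive]
    exact C0Semigroup.contractive_subset_closure_unitaries hH
  have key := hf.preimage_mem_residual_iff hd (hr ▸ C0Semigroup.isGδ_unitaries)
    (s := {T | Φ T})
  tfae_have 1 ↔ 2 := Iff.rfl
  tfae_have 2 ↔ 3 := key
  tfae_finish
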